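/- For integers $1\le k\le n$, let \textsc{Restricted Range Associativity} be the following problem. The oracle input is a binary operation $\circ:[n]\times[n]\to[k]$, where $[k]=\{1,\dots,k\}\subseteq[n]=\{1,\dots,n\}$. The required output is a non-associative triple, i.e. some $(a,b,c)\in[n]^3$ with $(a\circ b)\circ c\ne a\circ(b\circ c)$, if there is any, and otherwise "reject". For $k=O(1)$ this problem can be solved with high probability in quantum query complexity $O(n^{5/4})$. That is, for every $K\in\mathbb N$ and every $\varepsilon>0$ there is a constant $C$ (depending only on $K$ and $\varepsilon$) such that for all integers $1\le k\le n$ with $k\le K$ there is a quantum query algorithm that makes at most $C\,n^{5/4}$ queries and that, for every operation $\circ:[n]\times[n]\to[k]$, gives a correct output with probability at least $1-\varepsilon$. Here a quantum query algorithm with $T$ queries applies $U_0,O,U_1,O,\dots,O,U_T$ to a fixed basis state and then measures in the computational basis, the output being a function of the result; the unitaries $U_0,\dots,U_T$ do not depend on $\circ$, and the query is $O\,|a,b\rangle|y\rangle|w\rangle=|a,b\rangle|y+(a\circ b)\bmod k\rangle|w\rangle$, where $w$ ranges over the basis of a finite work register and the answer register is indexed by the residues modulo $k$. -/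

import Mathlib

/-- A quantum query algorithm with oracle access to a function `X → Y` and with outcomes in `A`.
Its state space has the computational basis `X × Y × W`: a query register, an answer register and a
finite work register. The unitaries `U 0, …, U queries` do not depend on the oracle; they are
unrestricted, since only queries are charged. -/
structure QuantumQueryAlgorithm (X Y A : Type) [Fintype X] [DecidableEq X]
    [Fintype Y] [DecidableEq Y] where
  /-- basis of the work register -/
  W : Type
  [fintypeW : Fintype W]
  [decidableEqW : DecidableEq W]
  /-- number of oracle queries -/
  queries : ℕ
  /-- oracle-independent unitaries (only the indices `0, …, queries` are used) -/
  U : ℕ → Matrix.unitaryGroup (X × Y × W) ℂ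
  /-- initial basis state -/
  init : X × Y × W
  /-- outcome attached to each result of the final measurement in the computational basis -/
  output : X × Y × W → A

namespace QuantumQueryAlgorithm

attribute [instance] fintypeW decidableEqW

/-- The action of a query to `f` on basis states: `(x, y, w) ↦ (x, y + f x, w)`. -/
def queryPerm {X Y : Type} [AddGroup Y] (W : Type) (f : X → Y) : Equiv.Perm (X × Y × W) where
  toFun z := (z.1, z.2.1 + f z.1, z.2.2)
  invFun z := (z.1, z.2.1 - f z.1, z.2.2)
  left_inv z := by simp
  right_inv z := by simp

/-- The query operator, the linear extension of `queryPerm` to vectors of amplitudes. -/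
def applyQuery {X Y : Type} [AddGroup Y] {W : Type} (f : X → Y) (ψ : X × Y × W → ℂ) :
    X × Y × W → ℂ :=
  fun z => ψ ((queryPerm W f).symm z)

variable {X Y A : Type} [Fintype X] [DecidableEq X] [Fintype Y] [DecidableEq Y] [AddGroup Y]

/-- The state `U t · O_f · U (t-1) · ⋯ · O_f · U 0 |init⟩` after `t` queries to the oracle `f`. -/
def stateAfter (𝒜 : QuantumQueryAlgorithm X Y A) (f : X → Y) : ℕ → (X × Y × 𝒜.W → ℂ)
  | 0 => (𝒜.U 0).1.mulVec (Pi.single 𝒜.init 1)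
  | t + 1 => (𝒜.U (t + 1)).1.mulVec (applyQuery f (stateAfter 𝒜 f t))

open Classical in
/-- The probability that the algorithm, run with oracle `f`, has its outcome in `S`. -/
noncomputable def outcomeProb (𝒜 : QuantumQueryAlgorithm X Y A) (f : X → Y) (S : Set A) : ℝ :=
  ∑ z : X × Y × 𝒜.W, if 𝒜.output z ∈ S then ‖𝒜.stateAfter f 𝒜.queries z‖ ^ 2 else 0

end QuantumQueryAlgorithm

/-- `(a, b, c)` is a non-associative triple of the operation `op : [n] × [n] → [k]`, `k ≤ n`, where
`[k]` is regarded as the initial segment of `[n]`: `(a ∘ b) ∘ c ≠ a ∘ (b ∘ c)`. -/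
def IsNonAssociativeTriple {n k : ℕ} (hkn : k ≤ n) (op : Fin n × Fin n → Fin k)
    (t : Fin n × Fin n × Fin n) : Prop :=
  op (Fin.castLE hkn (op (t.1, t.2.1)), t.2.2) ≠ op (t.1, Fin.castLE hkn (op (t.2.1, t.2.2)))

/-- The correct answers (`none` is "reject"): any non-associative triple if there is one, and
otherwise only "reject". -/
def associativityAnswers {n k : ℕ} (hkn : k ≤ n) (op : Fin n × Fin n → Fin k) :
    Set (Option (Fin n × Fin n × Fin n)) :=
  {o | (∃ t, o = some t ∧ IsNonAssociativeTriple hkn op t) ∨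
    (o = none ∧ ∀ t, ¬ IsNonAssociativeTriple hkn op t)}

/-! Fix the middle element `b`. If `a ∘ b = x`, `a ∘ y = v`, `b ∘ c = y` and `x ∘ c = u`, then `(a ∘
b) ∘ c = u` and `a ∘ (b ∘ c) = v`. Once `x, y, u, v` are fixed, the conditions on `a` and on `c` are
therefore independent. Hence `b` is tested by at most `k ^ 3` searches for `a` and as many for `c`,
each of cost `O(√n)`, and an outer search over `b` costs another factor `O(√n)`. The total is `O(k ^
3 * n)`, which is stronger than the required `n ^ (5 / 4)`.

Nesting bounded-error searches would require error control, so costs are counted in the dual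
adversary bound, which composes exactly. `AdversaryComputes.prod`, `comp`, `pi` and `search` form
its calculus. Taking first elements turns the search problems into functions.
`exists_of_adversaryComputes` then converts the bound into an algorithm once, at the end, with
constant-factor loss. -/

/-! ### Calculus of the dual adversary bound -/

/-- The kernel `κ` on oracles is a signed sum over the queries `x` of Gram kernels restricted to the
pairs of oracles that differ at `x`, and the vectors have squared norm at most `c`: a feasible
solution of value `c` of the dual adversary bound for `κ`. -/
def HasAdversaryBound {X Y : Type} [Fintype X] [DecidableEq Y]
    (κ : (X → Y) → (X → Y) → ℝ) (c : ℝ) : Prop :=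
  ∃ (ι : Type) (_ : Fintype ι) (s : ι → Bool) (p : (X → Y) → X → ι → ℝ),
    (∀ f g, κ f g = ∑ x, ∑ i, if f x = g x then 0 else
      (if s i then 1 else -1) * (p f x i * p g x i)) ∧
    ∀ f, ∑ x, ∑ i, p f x i ^ 2 ≤ c

namespace HasAdversaryBound

variable {X Y : Type} [Fintype X] [DecidableEq Y]

theorem mono {κ : (X → Y) → (X → Y) → ℝ} {c d : ℝ} (h : HasAdversaryBound κ c) (hcd : c ≤ d) :
    HasAdversaryBound κ d := by
  obtain ⟨ι, _, s, p, h1, h2⟩ := h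
  exact ⟨ι, _, s, p, h1, fun f => (h2 f).trans hcd⟩

theorem nonneg [Nonempty Y] {κ : (X → Y) → (X → Y) → ℝ} {c : ℝ}
    (h : HasAdversaryBound κ c) : 0 ≤ c := by
  obtain ⟨ι, _, s, p, h1, h2⟩ := h
  refine le_trans ?_ (h2 (fun _ => Classical.arbitrary Y))
  positivity

theorem query [DecidableEq X] (x : X) :
    HasAdversaryBound (fun f g : X → Y => if f x = g x then 0 else 1) 1 := by
  refine ⟨Unit, inferInstance, fun _ => true, fun _ x' _ => if x' = x then 1 else 0, ?_, ?_⟩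
  · intro f g
    rw [Finset.sum_eq_single x]
    · simp
    · intro b _ hb
      simp [hb]
    · simp
  · intro f
    simp

theorem neg {κ : (X → Y) → (X → Y) → ℝ} {c : ℝ} (h : HasAdversaryBound κ c) :
    HasAdversaryBound (fun f g => -κ f g) c := by
  obtain ⟨ι, _, s, p, h1, h2⟩ := h
  refine ⟨ι, _, fun i => !s i, p, fun f g => ?_, h2⟩
  simp only [h1]
  rw [← Finset.sum_neg_distrib]
  refine Finset.sum_congr rfl fun x _ => ?_
  rw [← Finset.sum_neg_distrib]
  refine Finset.sum_congr rfl fun i _ => ?_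
  split_ifs <;> simp_all

/-- Scaling the vectors of the `m`-th solution by `r m f` multiplies its kernel by `r m f * r m g`;
the direct sum over `m` adds kernels and squared norms. This is the composition rule: `r` is an
outer solution and the `κ m` are inner ones. -/
theorem weighted_sum {M : Type} [Fintype M] {κ : M → (X → Y) → (X → Y) → ℝ} {c : M → ℝ} {C : ℝ}
    (h : ∀ m, HasAdversaryBound (κ m) (c m)) (r : M → (X → Y) → ℝ)
    (hr : ∀ f, ∑ m, r m f ^ 2 * c m ≤ C) :
    HasAdversaryBound (fun f g => ∑ m, r m f * r m g * κ m f g) C := by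
  choose ι hι s p h1 h2 using h
  refine ⟨Σ m, ι m, inferInstance, fun i => s i.1 i.2, fun f x i => r i.1 f * p i.1 f x i.2,
    fun f g => ?_, fun f => le_trans ?_ (hr f)⟩
  · simp only [Fintype.sum_sigma]
    rw [Finset.sum_comm]
    refine Finset.sum_congr rfl fun m _ => ?_
    rw [h1, Finset.mul_sum]
    refine Finset.sum_congr rfl fun x _ => ?_
    rw [Finset.mul_sum]
    refine Finset.sum_congr rfl fun i _ => ?_
    split_ifs <;> ring
  · simp only [Fintype.sum_sigma]
    rw [Finset.sum_comm]
    refine Finset.sum_le_sum fun m _ => ?_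
    simp only [mul_pow, ← Finset.mul_sum]
    exact mul_le_mul_of_nonneg_left (h2 m f) (sq_nonneg _)

theorem add {κ μ : (X → Y) → (X → Y) → ℝ} {c d : ℝ} (hκ : HasAdversaryBound κ c)
    (hμ : HasAdversaryBound μ d) : HasAdversaryBound (fun f g => κ f g + μ f g) (c + d) := by
  have := weighted_sum (M := Bool) (κ := fun b => if b then κ else μ)
    (c := fun b => if b then c else d) (C := c + d) (by rintro (_ | _) <;> simpa) (fun _ _ => 1)
    (by simp)
  simpa using this

/-- With indicator weights only the solution for the value `t f` is active, so the cost is that of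
one branch rather than the sum over branches. -/
theorem conditional {T : Type} [Fintype T] [DecidableEq T]
    {κ : T → (X → Y) → (X → Y) → ℝ} {c : ℝ}
    (h : ∀ t, HasAdversaryBound (κ t) c) (t : (X → Y) → T) :
    HasAdversaryBound (fun f g => if t f = t g then κ (t f) f g else 0) c := by
  have := weighted_sum h (fun a f => if t f = a then 1 else 0) (C := c) (by simp)
  convert this using 3 with f g
  rw [Finset.sum_eq_single (t f)]
  · by_cases hfg : t f = t g
    · simp [hfg]
    · simp [hfg, Ne.symm hfg]
  · intro b _ hb
    simp [hb.symm]
  · simp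

end HasAdversaryBound

/-- The function `h` of the oracle has dual adversary bound at most `c`. -/
def AdversaryComputes {X Y T : Type} [Fintype X] [DecidableEq Y] [DecidableEq T]
    (h : (X → Y) → T) (c : ℝ) : Prop :=
  HasAdversaryBound (fun f g => if h f = h g then 0 else 1) c

namespace AdversaryComputes

variable {X Y T T' : Type} [Fintype X] [DecidableEq Y] [DecidableEq T] [DecidableEq T']

theorem congr {h : (X → Y) → T} {h' : (X → Y) → T'} {c : ℝ} (H : AdversaryComputes h c)
    (hh : ∀ f g, h f = h g ↔ h' f = h' g) : AdversaryComputes h' c := by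
  unfold AdversaryComputes at *
  simpa only [hh] using H

theorem mono {h : (X → Y) → T} {c d : ℝ} (H : AdversaryComputes h c) (hcd : c ≤ d) :
    AdversaryComputes h d :=
  HasAdversaryBound.mono H hcd

theorem eval [DecidableEq X] (x : X) : AdversaryComputes (fun f : X → Y => f x) 1 :=
  HasAdversaryBound.query x

/-- Adaptive composition: two pairs differ either in the first entry, or they share it, and then the
second function is the same for both oracles. -/
theorem prod [Fintype T] {h : (X → Y) → T} {h' : T → (X → Y) → T'} {c d : ℝ}
    (H : AdversaryComputes h c) (H' : ∀ t, AdversaryComputes (h' t) d) :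
    AdversaryComputes (fun f => (h f, h' (h f) f)) (c + d) := by
  have := HasAdversaryBound.add H (HasAdversaryBound.conditional H' h)
  unfold AdversaryComputes
  convert this using 3 with f g
  by_cases hfg : h f = h g <;> simp [hfg]

/-- Post-processing may merge values of `h`. The pairs merged by `φ` are subtracted from the kernel
of `h`, by the conditional of its negative; this costs the factor 2. -/
theorem comp [Fintype T'] {h : (X → Y) → T} {c : ℝ} (H : AdversaryComputes h c) (φ : T → T') :
    AdversaryComputes (fun f => φ (h f)) (2 * c) := by
  have := HasAdversaryBound.add H
    (HasAdversaryBound.conditional (fun _ : T' => HasAdversaryBound.neg H) (fun f => φ (h f)))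
  rw [two_mul]
  unfold AdversaryComputes
  convert this using 3 with f g
  by_cases hfg : h f = h g
  · simp [hfg]
  · by_cases h' : φ (h f) = φ (h g) <;> simp [hfg, h']

theorem pi {ι : Type} [Fintype ι] [DecidableEq ι] [Fintype T] {h : ι → (X → Y) → T} {c : ℝ}
    (H : ∀ i, AdversaryComputes (h i) c) :
    AdversaryComputes (fun f i => h i f) (Fintype.card ι * c) := by
  have key : ∀ s : Finset ι, AdversaryComputes (fun f (i : s) => h i f) (s.card * c) := by
    intro s
    induction s using Finset.induction_on with
    | empty =>
      refine ⟨Empty, inferInstance, fun _ => true, fun _ _ _ => 0, ?_, ?_⟩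
      · intro f g
        simp [Subsingleton.elim (fun i : (∅ : Finset ι) => h i f) (fun i => h i g)]
      · simp
    | insert j s hj ih =>
      have := ih.prod (fun _ => H j)
      rw [Finset.card_insert_of_notMem hj, Nat.cast_succ, add_mul, one_mul]
      refine this.congr fun f g => ?_
      simp only [Prod.mk.injEq, funext_iff, Subtype.forall, Finset.mem_insert, forall_eq_or_imp]
      tauto
  refine (key Finset.univ).congr fun f g => ?_
  simp [funext_iff]

end AdversaryComputes

/-! ### Search for the first marked index -/

/-- The least index at which `z` is true, if there is one. -/
noncomputable def firstTrue {n : ℕ} (z : Fin n → Bool) : Option (Fin n) :=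
  open Classical in
  if h : ∃ i, z i = true then some (Finset.min' {i | z i = true} (by simpa [Finset.Nonempty] using h))
  else none

theorem firstTrue_eq_some {n : ℕ} {z : Fin n → Bool} {i : Fin n} :
    firstTrue z = some i ↔ z i = true ∧ ∀ j < i, z j = false := by
  unfold firstTrue
  split_ifs with h
  · rw [Option.some_inj, Finset.min'_eq_iff]
    simp only [Finset.mem_filter, Finset.mem_univ, true_and]
    refine and_congr_right fun _ => forall_congr' fun j => ?_
    rw [← not_lt, imp_not_comm]
    simp
  · simp_all

theorem firstTrue_eq_none {n : ℕ} {z : Fin n → Bool} :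
    firstTrue z = none ↔ ∀ i, z i = false := by
  unfold firstTrue
  split_ifs with h
  · simpa using h
  · simpa using h

/-- The weight of index `m` in the adversary solution of the search for the first marked index. -/
noncomputable def searchWeight {n : ℕ} (s : ℝ) (z : Fin n → Bool) (m : Fin n) : ℝ :=
  if ∀ j < m, z j = false then (if z m then s else s⁻¹) else 0

theorem searchWeight_sum_of_lt {n : ℕ} {s : ℝ} (hs : 0 < s) {z z' : Fin n → Bool} {m : Fin n}
    (hm : z m = true) (hm' : z' m = false) (h : ∀ j < m, z j = false) (h' : ∀ j < m, z' j = false) :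
    ∑ i, searchWeight s z i * searchWeight s z' i * (if z i = z' i then 0 else 1) = 1 := by
  rw [Finset.sum_eq_single m]
  · rw [searchWeight, searchWeight, if_pos h, if_pos h']
    simp [hm, hm', hs.ne']
  · intro i _ hi
    rcases lt_or_gt_of_ne hi with hi | hi
    · simp [h i hi, h' i hi]
    · have : ¬ ∀ j < i, z j = false := fun H => by simp [H m hi] at hm
      simp [searchWeight, this]
  · simp

/-- The weights vanish after the first marked index, so only the first index where `z` and `z'`
differ can contribute, and only if nothing before it is marked. There one weight is `s` and the
other `s⁻¹`, with product 1. -/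
theorem searchWeight_sum {n : ℕ} {s : ℝ} (hs : 0 < s) (z z' : Fin n → Bool) :
    ∑ i, searchWeight s z i * searchWeight s z' i * (if z i = z' i then 0 else 1) =
      if firstTrue z = firstTrue z' then 0 else 1 := by
  by_cases hne : ∃ m, z m ≠ z' m ∧ (∀ j < m, z j = false) ∧ ∀ j < m, z' j = false
  · obtain ⟨m, hm, h, h'⟩ := hne
    have hfirst : firstTrue z ≠ firstTrue z' := by
      cases hz : z m
      · have hz' : z' m = true := by simpa [hz] using hm.symm
        rw [firstTrue_eq_some.2 ⟨hz', h'⟩, Ne, firstTrue_eq_some]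
        simp [hz]
      · have hz' : z' m = false := by simpa [hz] using hm.symm
        rw [firstTrue_eq_some.2 ⟨hz, h⟩, Ne, eq_comm, firstTrue_eq_some]
        simp [hz']
    rw [if_neg hfirst]
    cases hz : z m
    · have hz' : z' m = true := by simpa [hz] using hm.symm
      refine Eq.trans (Finset.sum_congr rfl fun i _ => ?_) (searchWeight_sum_of_lt hs hz' hz h' h)
      rw [mul_comm (searchWeight s z i)]
      simp only [eq_comm]
    · exact searchWeight_sum_of_lt hs hz (by simpa [hz] using hm.symm) h h'
  · push Not at hne
    have hagree : ∀ m, (∀ j < m, z j = false) → (∀ j < m, z' j = false) → z m = z' m := by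
      intro m h h'
      by_contra hm
      obtain ⟨j, hj, hj'⟩ := hne m hm h
      simp [h' j hj] at hj'
    -- Without a distinguishing index, agreement propagates by induction: the unmarked prefixes of
    -- `z` and `z'` coincide.
    have hprefix : ∀ m : Fin n, (∀ j < m, z j = false) ↔ ∀ j < m, z' j = false := by
      intro m
      induction m using WellFoundedLT.induction with
      | ind m ih =>
        constructor
        · intro h j hj
          have hz := fun i hi => h i (lt_trans hi hj)
          rw [← hagree j hz ((ih j hj).1 hz), h j hj]
        · intro h j hj
          have hz := fun i hi => h i (lt_trans hi hj)
          rw [hagree j ((ih j hj).2 hz) hz, h j hj]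
    have hfirst : firstTrue z = firstTrue z' := by
      refine Option.ext fun i => ?_
      rw [firstTrue_eq_some, firstTrue_eq_some, ← hprefix]
      exact and_congr_left fun h => by rw [hagree i h ((hprefix i).1 h)]
    rw [if_pos hfirst]
    refine Finset.sum_eq_zero fun i _ => ?_
    by_cases h : ∀ j < i, z j = false
    · simp [hagree i h ((hprefix i).1 h)]
    · simp [searchWeight, h]

theorem searchWeight_sq_sum_le {n : ℕ} {s : ℝ} (z : Fin n → Bool) :
    ∑ i, searchWeight s z i ^ 2 ≤ n * (s⁻¹) ^ 2 + s ^ 2 := by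
  have hle : ∀ i, searchWeight s z i ^ 2 ≤ (s⁻¹) ^ 2 + if firstTrue z = some i then s ^ 2 else 0 := by
    intro i
    unfold searchWeight
    simp only [firstTrue_eq_some]
    by_cases h : ∀ j < i, z j = false
    · by_cases hz : z i = true
      · rw [if_pos h, if_pos hz, if_pos ⟨hz, h⟩]
        nlinarith [sq_nonneg s⁻¹]
      · rw [if_pos h, if_neg hz, if_neg fun H => hz H.1, add_zero]
    · rw [if_neg h, if_neg fun H => h H.2, add_zero, zero_pow two_ne_zero]
      positivity
  refine (Finset.sum_le_sum fun i _ => hle i).trans ?_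
  rw [Finset.sum_add_distrib]
  have : ∑ i, (if firstTrue z = some i then s ^ 2 else 0) ≤ s ^ 2 := by
    cases firstTrue z with
    | none => simpa using sq_nonneg s
    | some m => simp
  simpa using this

theorem AdversaryComputes.search {X Y : Type} [Fintype X] [DecidableEq Y] [Nonempty Y] {n : ℕ}
    (hn : 0 < n) {z : Fin n → (X → Y) → Bool} {c : ℝ} (H : ∀ i, AdversaryComputes (z i) c) :
    AdversaryComputes (fun f => firstTrue fun i => z i f) (2 * √n * c) := by
  have hn' : (0 : ℝ) < √n := Real.sqrt_pos.2 (by exact_mod_cast hn)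
  have hc : 0 ≤ c := HasAdversaryBound.nonneg (H ⟨0, hn⟩)
  -- The choice `s = n ^ (1 / 4)` balances `n * s⁻¹ ^ 2` and `s ^ 2`, both equal to `√n`.
  have hs : 0 < √√(n : ℝ) := Real.sqrt_pos.2 hn'
  have := HasAdversaryBound.weighted_sum H (fun i f => searchWeight (√√n) (fun i => z i f) i)
    (C := 2 * √n * c) (fun f => by
      rw [← Finset.sum_mul]
      refine mul_le_mul_of_nonneg_right ((searchWeight_sq_sum_le _).trans (le_of_eq ?_)) hc
      rw [inv_pow, Real.sq_sqrt hn'.le, ← div_eq_mul_inv, Real.div_sqrt]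
      ring)
  unfold AdversaryComputes
  convert this using 3 with f g
  exact (searchWeight_sum hs _ _).symm

/-! ### From an adversary bound to a query algorithm -/

/-- Equal Gram matrices make the map from combinations of the `u i` to the same combinations of the
`v i` a well-defined isometry on their span; in finite dimension it extends to a unitary. -/
theorem exists_unitary_mulVec_eq {Z I : Type} [Fintype Z] [DecidableEq Z] [Fintype I]
    (u v : I → Z → ℝ) (h : ∀ i j, ∑ z, u i z * u j z = ∑ z, v i z * v j z) :
    ∃ U : Matrix.unitaryGroup Z ℂ,
      ∀ i, U.1.mulVec (fun z => (u i z : ℂ)) = fun z => (v i z : ℂ) := by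
  classical
  let vec : (I → Z → ℝ) → I → EuclideanSpace ℂ Z := fun w i => WithLp.toLp 2 fun z => (w i z : ℂ)
  let A := Fintype.linearCombination ℂ (vec u)
  let B := Fintype.linearCombination ℂ (vec v)
  have hinner : ∀ (w : I → Z → ℝ) i j,
      inner ℂ (vec w i) (vec w j) = ((∑ z, w i z * w j z : ℝ) : ℂ) := by
    intro w i j
    simp [vec, PiLp.inner_apply, mul_comm]
  have hnorm : ∀ c, ‖A c‖ = ‖B c‖ := by
    intro c
    rw [@norm_eq_sqrt_re_inner ℂ, @norm_eq_sqrt_re_inner ℂ]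
    simp only [A, B, Fintype.linearCombination_apply, sum_inner, inner_sum, inner_smul_left,
      inner_smul_right, hinner, h]
  obtain ⟨g, hg⟩ := A.rangeRestrict.exists_rightInverse_of_surjective A.range_rangeRestrict
  have hAg : ∀ s, A (g s) = s := fun s => congrArg Subtype.val (LinearMap.congr_fun hg s)
  let L : LinearMap.range A →ₗᵢ[ℂ] EuclideanSpace ℂ Z :=
    { toLinearMap := B ∘ₗ g
      norm_map' := fun s => by
        rw [LinearMap.comp_apply, ← hnorm, hAg]
        rfl }
  have hL : ∀ c, L.extend (A c) = B c := by
    intro c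
    have := L.extend_apply ⟨A c, c, rfl⟩
    rw [this, ← sub_eq_zero, ← norm_eq_zero]
    change ‖B (g _) - B c‖ = 0
    rw [← map_sub, ← hnorm, map_sub, hAg, sub_self, norm_zero]
  let V := L.extend.toLinearIsometryEquiv rfl
  let b := EuclideanSpace.basisFun Z ℂ
  refine ⟨⟨_, V.toMatrix_mem_unitaryGroup b b⟩, fun i => ?_⟩
  have hV : V (vec u i) = vec v i := by
    have := hL (Pi.single i 1)
    simp only [A, B, Fintype.linearCombination_apply_single, one_smul] at this
    exact this
  have := LinearMap.toMatrix_mulVec_repr b.toBasis b.toBasis V.toLinearEquiv.toLinearMap (vec u i)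
  funext z
  have hz := congrFun this z
  simp only [OrthonormalBasis.coe_toBasis_repr_apply] at hz
  have e1 : (fun z => (u i z : ℂ)) = ⇑(b.toBasis.repr (vec u i)) := by
    funext z
    simp [b, vec]
  rw [e1]
  refine (congrFun this z).trans ?_
  change b.toBasis.repr (V (vec u i)) z = _
  rw [hV]
  simp [b, vec]

theorem sum_norm_sq_unitary_mulVec {Z : Type} [Fintype Z] [DecidableEq Z]
    (U : Matrix.unitaryGroup Z ℂ) (ψ : Z → ℂ) :
    ∑ z, ‖U.1.mulVec ψ z‖ ^ 2 = ∑ z, ‖ψ z‖ ^ 2 := by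
  have key : ∀ φ : Z → ℂ, ((∑ z, ‖φ z‖ ^ 2 : ℝ) : ℂ) = star φ ⬝ᵥ φ := by
    intro φ
    simp [dotProduct, Complex.conj_mul']
  have hU : star U.1 * U.1 = 1 := Matrix.mem_unitaryGroup_iff'.1 U.2
  apply Complex.ofReal_injective
  rw [key, key, Matrix.star_mulVec, Matrix.dotProduct_mulVec, Matrix.vecMul_vecMul,
    ← Matrix.star_eq_conjTranspose, hU, Matrix.vecMul_one]

/-- For `d ≤ m` this is `2 * m * d ≤ δ * m ^ 2 + d ^ 2 / δ` applied to `(m - d) ^ 2 ≤ a ^ 2`; for `m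
≤ d` the left side is not positive. -/
theorem one_sub_mul_sq_sub_sq_div_le {δ m d a : ℝ} (hδ : 0 < δ) (hm : 0 ≤ m)
    (h : m ≤ d + a) : (1 - δ) * m ^ 2 - d ^ 2 / δ ≤ a ^ 2 := by
  rw [sub_le_iff_le_add, ← sub_le_iff_le_add', le_div_iff₀ hδ]
  rcases le_total m d with hmd | hmd
  · have h1 : m ^ 2 ≤ d ^ 2 := by gcongr
    nlinarith [mul_nonneg (sq_nonneg (δ - 1 / 2)) (sq_nonneg m), mul_nonneg hδ.le (sq_nonneg a),
      sq_nonneg m]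
  · have h1 : (m - d) ^ 2 ≤ a ^ 2 := by
      have : 0 ≤ m - d := sub_nonneg.2 hmd
      gcongr
      linarith
    nlinarith [mul_le_mul_of_nonneg_left h1 hδ.le, sq_nonneg (δ * m - d),
      mul_nonneg hδ.le (sq_nonneg d)]

namespace QuantumQueryAlgorithm

theorem applyQuery_apply {X Y W : Type} [AddGroup Y] (f : X → Y) (ψ : X × Y × W → ℂ) (x : X) (y : Y)
    (w : W) : applyQuery f ψ (x, y, w) = ψ (x, y - f x, w) :=
  rfl

theorem sum_norm_sq_applyQuery {X Y W : Type} [Fintype X] [Fintype Y] [Fintype W] [AddGroup Y]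
    (f : X → Y) (ψ : X × Y × W → ℂ) :
    ∑ z, ‖applyQuery f ψ z‖ ^ 2 = ∑ z, ‖ψ z‖ ^ 2 :=
  Equiv.sum_comp (queryPerm W f).symm fun z => ‖ψ z‖ ^ 2

section CatalyticState

variable {X Y A ι : Type} [DecidableEq X] [Fintype Y] [DecidableEq Y]
  [DecidableEq A] {T : ℕ}

/-- The sum of a superposition over `t` of the basis states `(t, e t)`, with query register `x₀` and
a uniform answer register, and of the catalyst `∑ x, ∑ i, p x i |x, q x i, i⟩`. -/
noncomputable def catalyticState (x₀ : X) (e : Fin T → Option A) (q : X → ι → Y) (p : X → ι → ℝ) :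
    X × Y × (Fin T × Option A ⊕ ι) → ℝ
  | (x, _, Sum.inl (t, b)) => if x = x₀ ∧ b = e t then (√(Fintype.card Y))⁻¹ else 0
  | (x, y, Sum.inr i) => if y = q x i then p x i else 0

/-- The uniform answer register makes the slot part invariant under a query, so only the catalyst
moves. -/
theorem applyQuery_catalyticState [AddGroup Y] (f : X → Y) (x₀ : X) (e : Fin T → Option A)
    (q : X → ι → Y) (p : X → ι → ℝ) :
    applyQuery f (fun z => (catalyticState x₀ e q p z : ℂ)) =
      fun z => (catalyticState x₀ e (fun x i => q x i + f x) p z : ℂ) := by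
  funext ⟨x, y, w⟩
  rw [applyQuery_apply]
  rcases w with ⟨t, b⟩ | i
  · rfl
  · simp [catalyticState, sub_eq_iff_eq_add]

theorem sum_catalyticState_mul [Fintype X] [Fintype A] [Fintype ι] [Nonempty Y] (x₀ : X)
    (e e' : Fin T → Option A) (q q' : X → ι → Y) (p p' : X → ι → ℝ) :
    ∑ z, catalyticState x₀ e q p z * catalyticState x₀ e' q' p' z =
      (∑ t, if e t = e' t then 1 else 0) +
        ∑ x, ∑ i, if q x i = q' x i then p x i * p' x i else 0 := by
  have hcard : (0 : ℝ) < Fintype.card Y := by exact_mod_cast Fintype.card_pos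
  simp only [Fintype.sum_prod_type, Fintype.sum_sum_type, Finset.sum_add_distrib]
  congr 1
  · rw [Finset.sum_eq_single x₀]
    · have : ∀ t : Fin T, (∑ b : Option A, (if b = e t then (√(Fintype.card Y : ℝ))⁻¹ else 0) *
          (if b = e' t then (√(Fintype.card Y : ℝ))⁻¹ else 0)) =
          (Fintype.card Y : ℝ)⁻¹ * if e t = e' t then 1 else 0 := by
        intro t
        rw [Finset.sum_eq_single (e t)]
        · rw [if_pos rfl]
          split_ifs
          · rw [← mul_inv, Real.mul_self_sqrt hcard.le, mul_one]
          · simp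
        · intro b _ hb
          simp [hb]
        · simp
      simp only [catalyticState, true_and, this]
      rw [Finset.sum_const, Finset.card_univ, ← Finset.mul_sum, nsmul_eq_mul,
        mul_inv_cancel_left₀ hcard.ne']
    · intro x _ hx
      simp [catalyticState, hx]
    · simp
  · refine Finset.sum_congr rfl fun x _ => ?_
    rw [Finset.sum_comm]
    refine Finset.sum_congr rfl fun i _ => ?_
    rw [Finset.sum_eq_single (q x i)]
    · simp [catalyticState]
    · intro y _ hy
      simp [catalyticState, hy]
    · simp

end CatalyticState

/-- The ideal state is `T` slots plus a catalyst built from the adversary vectors. Each query lowers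
the catalyst's Gram matrix by exactly the kernel of `R`. This pays for writing `R f` into one more
slot while the catalyst is restored, so the same catalyst serves all `T` steps. The catalyst has
squared norm at most `c`, small against the `T` slots, so the algorithm may start without it. -/
theorem exists_of_adversaryComputes {X Y A : Type} [Fintype X] [DecidableEq X] [Nonempty X]
    [Fintype Y] [DecidableEq Y] [AddGroup Y] [Fintype A] [DecidableEq A] {R : (X → Y) → A} {c δ : ℝ}
    (h : AdversaryComputes R c) {T : ℕ} (hT : 0 < T) (hδ : 0 < δ) (hc : c ≤ δ ^ 2 * T) :
    ∃ 𝒜 : QuantumQueryAlgorithm X Y A, 𝒜.queries = T ∧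
      ∀ (f : X → Y) (S : Set A), R f ∈ S → 1 - 2 * δ ≤ 𝒜.outcomeProb f S := by
  classical
  obtain ⟨ι, _, s, p, hp, hpc⟩ := h
  obtain ⟨x₀⟩ := ‹Nonempty X›
  have hT' : (0 : ℝ) < √T := Real.sqrt_pos.2 (by exact_mod_cast hT)
  let W := Fin T × Option A ⊕ ι
  let e : ℕ → (X → Y) → Fin T → Option A := fun j f t => if t.1 < j then some (R f) else none
  -- Positive components carry 0 before the query and `f x` after it, negative ones `-f x` and then
  -- 0. Thus the query removes the overlap at `f x ≠ g x` for the former and creates it for the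
  -- latter.
  let q : (X → Y) → X → ι → Y := fun f x i => if s i then 0 else -f x
  let Ψ : ℕ → (X → Y) → X × Y × W → ℝ := fun j f => catalyticState x₀ (e j f) (q f) (p f)
  let start : X × Y × W := (x₀, 0, Sum.inl (⟨0, hT⟩, none))
  obtain ⟨U₀, hU₀⟩ := exists_unitary_mulVec_eq (I := Unit) (fun _ => Pi.single start (1 : ℝ))
    -- With no step done all slots are empty, so the oracle `0` is a dummy; the catalyst is absent.
    (fun _ z => (√T)⁻¹ * catalyticState x₀ (e 0 0) (q 0) 0 z) (by
      intro _ _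
      simp only [mul_mul_mul_comm _ _ (√(T : ℝ))⁻¹, ← Finset.mul_sum]
      rw [sum_catalyticState_mul, ← mul_inv, Real.mul_self_sqrt (Nat.cast_nonneg T)]
      have : (T : ℝ) ≠ 0 := by exact_mod_cast hT.ne'
      rw [Finset.sum_eq_single start (fun b _ hb => by simp [hb]) (by simp)]
      simp [this])
  have hstep : ∀ j, ∃ U : Matrix.unitaryGroup (X × Y × W) ℂ, j < T → ∀ f,
      U.1.mulVec (applyQuery f fun z => (Ψ j f z : ℂ)) = fun z => (Ψ (j + 1) f z : ℂ) := by
    intro j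
    by_cases hj : j < T
    swap
    · exact ⟨1, fun H => absurd H hj⟩
    -- One unitary must serve all oracles at once, hence the comparison of Gram matrices over all
    -- pairs `f, g`. Both sides differ from the Gram matrix before the query by the kernel of `R`.
    obtain ⟨U, hU⟩ := exists_unitary_mulVec_eq
      (fun f => catalyticState x₀ (e j f) (fun x i => q f x i + f x) (p f)) (Ψ (j + 1)) (by
        intro f g
        rw [sum_catalyticState_mul, sum_catalyticState_mul]
        have h1 : ∀ t : Fin T, (if e (j + 1) f t = e (j + 1) g t then (1 : ℝ) else 0) =
            (if e j f t = e j g t then 1 else 0) -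
              if t = ⟨j, hj⟩ then (if R f = R g then 0 else 1) else 0 := by
          intro t
          rcases lt_trichotomy t.1 j with ht | ht | ht
          · have : t ≠ ⟨j, hj⟩ := fun H => by simp [H] at ht
            simp [e, ht, this, Nat.lt_succ_of_lt ht]
          · obtain rfl : t = ⟨j, hj⟩ := Fin.ext ht
            by_cases hfg : R f = R g <;> simp [e, hfg]
          · have : t ≠ ⟨j, hj⟩ := fun H => by simp [H] at ht
            simp [e, this, ht.not_gt, Nat.not_lt.2 (Nat.succ_le_of_lt ht)]
        simp only [h1, Finset.sum_sub_distrib]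
        rw [Finset.sum_ite_eq', if_pos (Finset.mem_univ _), sub_add, sub_eq_add_neg]
        congr 1
        have hfg := hp f g
        beta_reduce at hfg
        rw [hfg]
        rw [← Finset.sum_sub_distrib, ← Finset.sum_neg_distrib]
        refine Finset.sum_congr rfl fun x _ => ?_
        rw [← Finset.sum_sub_distrib, ← Finset.sum_neg_distrib]
        refine Finset.sum_congr rfl fun i _ => ?_
        by_cases hfg : f x = g x <;> cases hs : s i <;> simp [q, hfg, hs])
    exact ⟨U, fun _ f => by rw [applyQuery_catalyticState]; exact hU f⟩
  choose V hV using hstep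
  let 𝒜 : QuantumQueryAlgorithm X Y A :=
    { W := W
      queries := T
      U := fun j => Nat.casesOn j U₀ V
      init := start
      output := fun z => match z with
        | (_, _, Sum.inl (_, some a)) => a
        -- An arbitrary answer for the outcomes in an empty slot or in the catalyst.
        | _ => R 0 }
  refine ⟨𝒜, rfl, fun f S hS => ?_⟩
  -- Initially the difference is the catalyst alone; queries and unitaries preserve its norm.
  have hdist : ∀ j ≤ T, ∑ z, ‖(Ψ j f z : ℂ) - √T * 𝒜.stateAfter f j z‖ ^ 2 ≤ c := by
    intro j
    induction j with
    | zero =>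
      intro _
      have h0 : 𝒜.stateAfter f 0 =
          fun z => (((√T)⁻¹ * catalyticState x₀ (e 0 0) (q 0) 0 z : ℝ) : ℂ) := by
        rw [← hU₀ ()]
        change U₀.1.mulVec _ = U₀.1.mulVec _
        congr 1
        funext z
        simp [Pi.single_apply, apply_ite Complex.ofReal, 𝒜]
      have h1 : ∀ z, ‖(Ψ 0 f z : ℂ) - √T * 𝒜.stateAfter f 0 z‖ ^ 2 =
          Ψ 0 f z * Ψ 0 f z - 2 * (Ψ 0 f z * catalyticState x₀ (e 0 0) (q 0) 0 z) +
            catalyticState x₀ (e 0 0) (q 0) 0 z * catalyticState x₀ (e 0 0) (q 0) 0 z := by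
        intro z
        rw [h0]
        simp only [← Complex.ofReal_mul, ← Complex.ofReal_sub, Complex.norm_real, Real.norm_eq_abs,
          sq_abs, mul_inv_cancel_left₀ hT'.ne']
        ring
      rw [Finset.sum_congr rfl fun z _ => h1 z, Finset.sum_add_distrib, Finset.sum_sub_distrib,
        ← Finset.mul_sum, sum_catalyticState_mul, sum_catalyticState_mul, sum_catalyticState_mul]
      refine le_trans (le_of_eq ?_) (hpc f)
      simp [e, pow_two]
      ring
    | succ j ih =>
      intro hj
      refine le_trans (le_of_eq ?_) (ih (Nat.le_of_succ_le hj))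
      conv_rhs => rw [← sum_norm_sq_applyQuery f, ← sum_norm_sq_unitary_mulVec (V j)]
      refine Finset.sum_congr rfl fun z _ => ?_
      congr 2
      have h1 : (fun z => (Ψ j f z : ℂ) - √T * 𝒜.stateAfter f j z) =
          (fun z => (Ψ j f z : ℂ)) - (√T : ℂ) • 𝒜.stateAfter f j := rfl
      have h2 : applyQuery f ((fun z => (Ψ j f z : ℂ)) - (√T : ℂ) • 𝒜.stateAfter f j) =
          applyQuery f (fun z => (Ψ j f z : ℂ)) - (√T : ℂ) • applyQuery f (𝒜.stateAfter f j) := rfl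
      rw [h1, h2, Matrix.mulVec_sub, Matrix.mulVec_smul, hV j hj f]
      rfl
  have hmain : ∑ z, catalyticState x₀ (e T f) (q f) 0 z ^ 2 = T := by
    simp only [pow_two]
    rw [sum_catalyticState_mul]
    simp
  -- After `T` steps every filled slot yields `R f`. Summed over `z`, the slots give `(1 - δ) * T`
  -- and the error at most `c / δ ≤ δ * T`.
  have hpoint : ∀ z, (1 - δ) * catalyticState x₀ (e T f) (q f) 0 z ^ 2 -
      ‖(Ψ T f z : ℂ) - √T * 𝒜.stateAfter f T z‖ ^ 2 / δ ≤
      T * if 𝒜.output z ∈ S then ‖𝒜.stateAfter f T z‖ ^ 2 else 0 := by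
    intro z
    by_cases hz : catalyticState x₀ (e T f) (q f) 0 z = 0
    · rw [hz]
      refine le_trans (b := 0) ?_ ?_
      · have : 0 ≤ ‖(Ψ T f z : ℂ) - √T * 𝒜.stateAfter f T z‖ ^ 2 / δ := by positivity
        simpa using this
      · split_ifs <;> positivity
    · obtain ⟨x, y, ⟨t, b⟩ | i⟩ := z
      · have hb : b = some (R f) := by
          by_contra hb
          exact hz (by simp [catalyticState, e, hb])
        have hout : 𝒜.output (x, y, Sum.inl (t, b)) ∈ S := by
          rw [hb]
          exact hS
        rw [if_pos hout]
        change (1 - δ) * Ψ T f (x, y, Sum.inl (t, b)) ^ 2 - _ ≤ _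
        generalize Ψ T f (x, y, Sum.inl (t, b)) = m
        generalize 𝒜.stateAfter f T (x, y, Sum.inl (t, b)) = a
        have h1 : (T : ℝ) * ‖a‖ ^ 2 = ‖√T * a‖ ^ 2 := by
          rw [norm_mul, mul_pow, Complex.norm_real, Real.norm_eq_abs, sq_abs,
            Real.sq_sqrt (Nat.cast_nonneg T)]
        rw [h1]
        generalize √T * a = a
        have h2 : |m| ≤ ‖(m : ℂ) - a‖ + ‖a‖ := by
          rw [← Real.norm_eq_abs, ← Complex.norm_real]
          simpa using norm_add_le ((m : ℂ) - a) a
        rw [← sq_abs m]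
        exact one_sub_mul_sq_sub_sq_div_le hδ (abs_nonneg m) h2
      · simp [catalyticState] at hz
  have hsum := Finset.sum_le_sum fun z (_ : z ∈ Finset.univ) => hpoint z
  rw [Finset.sum_sub_distrib, ← Finset.mul_sum, hmain, ← Finset.sum_div, ← Finset.mul_sum] at hsum
  have hfin : (∑ z, ‖(Ψ T f z : ℂ) - √T * 𝒜.stateAfter f T z‖ ^ 2) / δ ≤ δ * T := by
    rw [div_le_iff₀ hδ]
    linarith [hdist T le_rfl, pow_two δ]
  have hTpos : (0 : ℝ) < T := by exact_mod_cast hT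
  refine le_of_mul_le_mul_left ?_ hTpos
  change _ ≤ (T : ℝ) * ∑ z, _
  refine le_trans ?_ hsum
  linarith

end QuantumQueryAlgorithm

/-! ### Non-associative triples with a small range -/

section RestrictedRange

variable {n k : ℕ} (hkn : k ≤ n)

/-- The first `a` with `a ∘ b = x` and `a ∘ y = v`. -/
noncomputable def firstLeft (b : Fin n) (x y v : Fin k) (op : Fin n × Fin n → Fin k) :
    Option (Fin n) :=
  firstTrue fun a => decide (op (a, b) = x ∧ op (a, Fin.castLE hkn y) = v)

/-- The first `c` with `b ∘ c = y` and `x ∘ c = u`. -/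
noncomputable def firstRight (b : Fin n) (x y u : Fin k) (op : Fin n × Fin n → Fin k) :
    Option (Fin n) :=
  firstTrue fun c => decide (op (b, c) = y ∧ op (Fin.castLE hkn x, c) = u)

/-- For all values of `x`, `y`, `w`, the first left and the first right factors of `b`. -/
noncomputable def middleData (b : Fin n) (op : Fin n × Fin n → Fin k) (i : Fin k × Fin k × Fin k) :
    Option (Fin n) × Option (Fin n) :=
  (firstLeft hkn b i.1 i.2.1 i.2.2 op, firstRight hkn b i.1 i.2.1 i.2.2 op)

open Classical in
/-- A pair `(a, c)` such that `(a, b, c)` is not associative, read off from the middle data of `b`. -/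
noncomputable def outerPair (d : Fin k × Fin k × Fin k → Option (Fin n) × Option (Fin n)) :
    Option (Fin n × Fin n) :=
  if h : ∃ (ac : Fin n × Fin n) (x y u v : Fin k), u ≠ v ∧
    (d (x, y, v)).1 = some ac.1 ∧ (d (x, y, u)).2 = some ac.2 then some h.choose else none

theorem isNonAssociativeTriple_of_outerPair {op : Fin n × Fin n → Fin k} {b : Fin n}
    {ac : Fin n × Fin n} (h : outerPair (middleData hkn b op) = some ac) :
    IsNonAssociativeTriple hkn op (ac.1, b, ac.2) := by
  unfold outerPair at h
  split_ifs at h with H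
  obtain ⟨x, y, u, v, huv, h1, h2⟩ := H.choose_spec
  rw [Option.some_inj.1 h] at h1 h2
  have h1' := (firstTrue_eq_some.1 h1).1
  have h2' := (firstTrue_eq_some.1 h2).1
  simp only [decide_eq_true_eq] at h1' h2'
  unfold IsNonAssociativeTriple
  simp only [h1'.1, h1'.2, h2'.1, h2'.2]
  exact huv

/-- The first elements `a'` and `c'` may differ from `a` and `c`, but they realize the same values
`x, y, u, v`, and these alone decide non-associativity with `b`. -/
theorem outerPair_isSome {op : Fin n × Fin n → Fin k} {a b c : Fin n}
    (h : IsNonAssociativeTriple hkn op (a, b, c)) : (outerPair (middleData hkn b op)).isSome := by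
  have hsome : ∀ (z : Fin n → Bool) (i : Fin n), z i = true → ∃ j, firstTrue z = some j := by
    intro z i hi
    by_contra! H
    have := firstTrue_eq_none.1 (Option.eq_none_iff_forall_ne_some.2 H) i
    simp [hi] at this
  unfold outerPair
  rw [dif_pos]
  · rfl
  obtain ⟨a', ha'⟩ := hsome (fun a' => decide (op (a', b) = op (a, b) ∧
    op (a', Fin.castLE hkn (op (b, c))) = op (a, Fin.castLE hkn (op (b, c))))) a (by simp)
  obtain ⟨c', hc'⟩ := hsome (fun c' => decide (op (b, c') = op (b, c) ∧
    op (Fin.castLE hkn (op (a, b)), c') = op (Fin.castLE hkn (op (a, b)), c))) c (by simp)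
  exact ⟨(a', c'), _, _, _, _, h, ha', hc'⟩

/-- The first middle element of a non-associative triple. -/
noncomputable def firstMiddle (op : Fin n × Fin n → Fin k) : Option (Fin n) :=
  firstTrue fun b => (outerPair (middleData hkn b op)).isSome

/-- A non-associative triple whose middle element is as small as possible, if there is any. -/
noncomputable def nonAssociativeTriple (op : Fin n × Fin n → Fin k) :
    Option (Fin n × Fin n × Fin n) :=
  (firstMiddle hkn op).bind fun b =>
    (outerPair (middleData hkn b op)).map fun ac => (ac.1, b, ac.2)

theorem nonAssociativeTriple_mem (op : Fin n × Fin n → Fin k) :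
    nonAssociativeTriple hkn op ∈ associativityAnswers hkn op := by
  unfold nonAssociativeTriple
  cases hb : firstMiddle hkn op with
  | none =>
    refine Or.inr ⟨rfl, fun t ht => ?_⟩
    have := firstTrue_eq_none.1 hb t.2.1
    rw [outerPair_isSome hkn (a := t.1) (c := t.2.2) ht] at this
    exact Bool.noConfusion this
  | some b =>
    obtain ⟨ac, hac⟩ := Option.isSome_iff_exists.1 (firstTrue_eq_some.1 hb).1
    refine Or.inl ⟨(ac.1, b, ac.2), ?_, isNonAssociativeTriple_of_outerPair hkn hac⟩
    simp [hac]

variable [NeZero k]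

theorem adversaryComputes_firstTrue_pair (p p' : Fin n → Fin n × Fin n) (x x' : Fin k) (hn : 0 < n) :
    AdversaryComputes (fun op : Fin n × Fin n → Fin k =>
      firstTrue fun a => decide (op (p a) = x ∧ op (p' a) = x')) (8 * √n) := by
  have h : ∀ a, AdversaryComputes (fun op : Fin n × Fin n → Fin k =>
      decide (op (p a) = x ∧ op (p' a) = x')) (2 * (1 + 1)) := fun a =>
    ((AdversaryComputes.eval (p a)).prod fun _ => AdversaryComputes.eval (p' a)).comp
      fun y : Fin k × Fin k => decide (y.1 = x ∧ y.2 = x')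
  refine (AdversaryComputes.search hn h).mono (le_of_eq ?_)
  ring

theorem adversaryComputes_middleData (hn : 0 < n) (b : Fin n) :
    AdversaryComputes (middleData hkn b) (16 * (k : ℝ) ^ 3 * √n) := by
  have h : ∀ i, AdversaryComputes (fun op => middleData hkn b op i) (8 * √n + 8 * √n) := fun i =>
    (adversaryComputes_firstTrue_pair (fun a => (a, b)) (fun a => (a, Fin.castLE hkn i.2.1))
      i.1 i.2.2 hn).prod fun _ =>
        adversaryComputes_firstTrue_pair (fun c => (b, c)) (fun c => (Fin.castLE hkn i.1, c))
          i.2.1 i.2.2 hn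
  refine (AdversaryComputes.pi h).mono (le_of_eq ?_)
  simp only [Fintype.card_prod, Fintype.card_fin, Nat.cast_mul]
  ring

theorem adversaryComputes_firstMiddle (hn : 0 < n) :
    AdversaryComputes (firstMiddle hkn (k := k)) (64 * (k : ℝ) ^ 3 * n) := by
  refine (AdversaryComputes.search hn fun b =>
    (adversaryComputes_middleData hkn hn b).comp fun d => (outerPair d).isSome).mono (le_of_eq ?_)
  linear_combination 64 * (k : ℝ) ^ 3 * Real.mul_self_sqrt (Nat.cast_nonneg n)

theorem adversaryComputes_nonAssociativeTriple (hn : 0 < n) :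
    AdversaryComputes (nonAssociativeTriple hkn (k := k)) (160 * (k : ℝ) ^ 3 * n) := by
  -- Knowing the first good `b`, its middle data are computed again to extract the triple. The
  -- default index is queried only when there is no such `b`, and its data are then discarded by
  -- `bind`.
  have h := ((adversaryComputes_firstMiddle hkn hn (k := k)).prod
    (h' := fun o op => middleData hkn (o.getD ⟨0, hn⟩) op)
    fun o => adversaryComputes_middleData hkn hn (o.getD ⟨0, hn⟩)).comp
      fun d => d.1.bind fun b => (outerPair d.2).map fun ac => (ac.1, b, ac.2)
  have heq : (nonAssociativeTriple hkn (k := k)) = fun op =>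
      (firstMiddle hkn op).bind fun b =>
        (outerPair (middleData hkn ((firstMiddle hkn op).getD ⟨0, hn⟩) op)).map
          fun ac => (ac.1, b, ac.2) := by
    funext op
    unfold nonAssociativeTriple
    cases firstMiddle hkn op <;> rfl
  rw [heq]
  refine h.mono ?_
  have hsqrt : √(n : ℝ) ≤ n := by
    rw [Real.sqrt_le_left (Nat.cast_nonneg n)]
    have : (1 : ℝ) ≤ n := by exact_mod_cast hn
    nlinarith
  have := mul_le_mul_of_nonneg_left hsqrt (show 0 ≤ 32 * (k : ℝ) ^ 3 by positivity)
  linarith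

end RestrictedRange

/-! ### The query bound -/

theorem theorem7 (K : ℕ) (ε : ℝ) (hε : 0 < ε) :
    ∃ C : ℝ, ∀ (n k : ℕ) [NeZero k] (hkn : k ≤ n), k ≤ K →
      ∃ 𝒜 : QuantumQueryAlgorithm (Fin n × Fin n) (Fin k) (Option (Fin n × Fin n × Fin n)),
        (𝒜.queries : ℝ) ≤ C * (n : ℝ) ^ (5 / 4 : ℝ) ∧
        ∀ op : Fin n × Fin n → Fin k,
          1 - ε ≤ 𝒜.outcomeProb op (associativityAnswers hkn op) := by
  -- With `δ = ε / 2` the failure probability `2 * δ` is `ε`. The `+ 1` in the constant absorbs the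
  -- rounding up of the number of queries, as `1 ≤ n`.
  refine ⟨160 * (K : ℝ) ^ 3 / (ε / 2) ^ 2 + 1, fun n k _ hkn hkK => ?_⟩
  have hn : 0 < n := (Nat.pos_of_ne_zero (NeZero.ne k)).trans_le hkn
  have hn1 : (1 : ℝ) ≤ n := by exact_mod_cast hn
  have : Nonempty (Fin n × Fin n) := ⟨(⟨0, hn⟩, ⟨0, hn⟩)⟩
  have hδ : 0 < ε / 2 := half_pos hε
  set B : ℝ := 160 * (K : ℝ) ^ 3 / (ε / 2) ^ 2 with hB
  have hB0 : 0 ≤ B := by positivity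
  have hcost : 160 * (k : ℝ) ^ 3 * n ≤ (ε / 2) ^ 2 * (⌊B * n⌋₊ + 1 : ℕ) := by
    have h1 : 160 * (k : ℝ) ^ 3 * n ≤ 160 * (K : ℝ) ^ 3 * n := by gcongr
    have h2 : 160 * (K : ℝ) ^ 3 * n = (ε / 2) ^ 2 * (B * n) := by
      rw [hB]
      field_simp
    rw [h2] at h1
    refine h1.trans ?_
    gcongr
    exact_mod_cast (Nat.lt_floor_add_one (B * n)).le
  obtain ⟨𝒜, hq, h𝒜⟩ := QuantumQueryAlgorithm.exists_of_adversaryComputes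
    (adversaryComputes_nonAssociativeTriple hkn hn) (Nat.succ_pos ⌊B * n⌋₊) hδ hcost
  refine ⟨𝒜, ?_, fun op => ?_⟩
  · have hpow : (n : ℝ) ≤ (n : ℝ) ^ (5 / 4 : ℝ) := by
      simpa using Real.rpow_le_rpow_of_exponent_le hn1 (show (1 : ℝ) ≤ 5 / 4 by norm_num)
    rw [hq]
    push_cast
    have := Nat.floor_le (show 0 ≤ B * n by positivity)
    calc (⌊B * n⌋₊ : ℝ) + 1 ≤ B * n + n := by linarith
      _ = (B + 1) * n := by ring
      _ ≤ _ := by gcongr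
  · have := h𝒜 op _ (nonAssociativeTriple_mem hkn op)
    linarith
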